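/- Let $m\ge 5$ be an integer and let $M$ be an $m\times 2$ integer matrix none of whose rows is the zero row. Let $H\subseteq\mathbb Z^m$ be the subgroup generated by the two columns of $M$, let $e_1,\dots,e_m$ be the standard basis of $\mathbb Z^m$, and let $X$ be the standardized Abelian Cayley graph associated with $M$, i.e. the Cayley graph $\mathrm{Cay}\bigl(\mathbb Z^m/H,\{\pm e_1+H,\dots,\pm e_m+H\}\bigr)$: its vertices are the elements of $\mathbb Z^m/H$, and two (not necessarily distinct) vertices $g,h$ are adjacent if and only if $h-g=\pm e_i+H$ for some $i$ and some choice of sign. If $X$ is not bipartite and has no loops (i.e. no vertex is adjacent to itself), then its chromatic number is $\chi(X)=3$. -/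

import Mathlib

/-- An undirected graph in which loops are allowed: a symmetric, not necessarily irreflexive,
adjacency relation on the vertex type. -/
structure LoopGraph (V : Type*) where
  /-- The adjacency relation. -/
  Adj : V → V → Prop
  symm : ∀ u v, Adj u v → Adj v u

namespace LoopGraph

/-- Some vertex is adjacent to itself. -/
def HasLoop {V : Type*} (X : LoopGraph V) : Prop :=
  ∃ v, X.Adj v v

/-- The vertex set can be partitioned into two sets `A` and `B` such that every edge has one
endpoint in `A` and the other one in `B`. -/
def IsBipartite {V : Type*} (X : LoopGraph V) : Prop :=
  ∃ A B : Set V, A ∪ B = Set.univ ∧ Disjoint A B ∧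
    ∀ u v, X.Adj u v → (u ∈ A ∧ v ∈ B) ∨ (u ∈ B ∧ v ∈ A)

/-- There is a proper coloring with (at most) `n` colors. -/
def Colorable {V : Type*} (X : LoopGraph V) (n : ℕ) : Prop :=
  ∃ c : V → Fin n, ∀ u v, X.Adj u v → c u ≠ c v

/-- The minimum number of colors of a proper coloring; it is `⊤` when there is no proper coloring
with finitely many colors, in particular when the graph has a loop. -/
noncomputable def chromaticNumber {V : Type*} (X : LoopGraph V) : ℕ∞ :=
  ⨅ n ∈ {n : ℕ | X.Colorable n}, (n : ℕ∞)

/-- The Cayley graph of an additive commutative group `G` with respect to a symmetric subset `S`: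
each vertex `g` is adjacent to every vertex `g + s` with `s ∈ S`. -/
def cayley {G : Type*} [AddCommGroup G] (S : Set G) (hS : ∀ s ∈ S, -s ∈ S) : LoopGraph G where
  Adj g h := ∃ s ∈ S, h = g + s
  symm := by
    rintro g _ ⟨s, hs, rfl⟩
    exact ⟨-s, hS s hs, by abel⟩

end LoopGraph

/-- The subgroup of `ℤ^m` generated by the columns of an integer matrix with `m` rows. -/
def columnSubgroup {m r : ℕ} (M : Matrix (Fin m) (Fin r) ℤ) : AddSubgroup (Fin m → ℤ) :=
  AddSubgroup.closure (Set.range fun j : Fin r => fun i : Fin m => M i j)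

/-- The set of the classes of `e_1, -e_1, …, e_m, -e_m` in the quotient of `ℤ^m` by the subgroup
generated by the columns of `M`. -/
def standardGenerators {m r : ℕ} (M : Matrix (Fin m) (Fin r) ℤ) :
    Set ((Fin m → ℤ) ⧸ columnSubgroup M) :=
  {s | ∃ i : Fin m,
    s = QuotientAddGroup.mk (Pi.single i (1 : ℤ)) ∨ s = -QuotientAddGroup.mk (Pi.single i (1 : ℤ))}

theorem neg_mem_standardGenerators {m r : ℕ} (M : Matrix (Fin m) (Fin r) ℤ) :
    ∀ s ∈ standardGenerators M, -s ∈ standardGenerators M := by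
  rintro s ⟨i, rfl | rfl⟩
  · exact ⟨i, Or.inr rfl⟩
  · exact ⟨i, Or.inl (neg_neg _)⟩

/-- The standardized Abelian Cayley graph associated with an integer matrix `M` with `m` rows: the
Cayley graph of the quotient of `ℤ^m` by the subgroup generated by the columns of `M`, with respect
to the classes of `e_1, -e_1, …, e_m, -e_m`. -/
def sacg {m r : ℕ} (M : Matrix (Fin m) (Fin r) ℤ) :
    LoopGraph ((Fin m → ℤ) ⧸ columnSubgroup M) :=
  LoopGraph.cayley (standardGenerators M) (neg_mem_standardGenerators M)

/-! Giving each generator an angle `s i ∈ [1/3, 2/3]` (in turns) for which every column relation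
sums to an integer maps the graph to the circle, and cutting the circle into thirds 3-colors it.
With `s i = 1/2 + t i / 6` this asks that the zonotope of the rows contain `3z` for some integral
`z` congruent mod 2 to the sum of the rows: `HasTripledPoint`.

Non-bipartiteness makes some column sum odd; looplessness forbids integral combinations of the
columns of `ℓ¹` norm 1. Among combinations with odd sum take one of least norm `X`, so `X ≥ 3`; up
to a unimodular change of basis it is the first coordinate. Without a tripled point, a shear puts
the slice at abscissa 3 strictly between ordinates -3 and 3 (`hasTripledPoint_of_minimal`), and
minimality gives height at least `X`. Convexity and parity then leave only `X = 3` or `X = 5`, and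
both contradict having five nonzero rows (`slice_not_subset`). -/

/-! ### Zonotopes and tripled points -/

/-- The zonotope spanned by the integer vectors `(x i, y i)`. -/
def zonotope {ι : Type*} [Fintype ι] (x y : ι → ℤ) : Set (ℝ × ℝ) :=
  {p | ∃ t : ι → ℝ, (∀ i, |t i| ≤ 1) ∧ ∑ i, t i * x i = p.1 ∧ ∑ i, t i * y i = p.2}

/-- The zonotope contains a point `3 z` with `z` integral and congruent to the sum of the
spanning vectors modulo `2`. -/
def HasTripledPoint {ι : Type*} [Fintype ι] (x y : ι → ℤ) : Prop :=
  ∃ p q : ℤ, ((3 * p : ℝ), (3 * q : ℝ)) ∈ zonotope x y ∧ 2 ∣ p - ∑ i, x i ∧ 2 ∣ q - ∑ i, y i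

section Zonotope

variable {ι : Type*} [Fintype ι]

theorem zonotope_convex (x y : ι → ℤ) : Convex ℝ (zonotope x y) := by
  rintro ⟨p, q⟩ ⟨t, ht, hp, hq⟩ ⟨p', q'⟩ ⟨t', ht', hp', hq'⟩ α β hα hβ hαβ
  simp only at hp hq hp' hq'
  refine ⟨fun i => α * t i + β * t' i, fun i => ?_, ?_, ?_⟩
  · have h1 := abs_le.1 (ht i)
    have h2 := abs_le.1 (ht' i)
    rw [abs_le]
    constructor <;> nlinarith
  · simp only [Prod.fst_add, Prod.smul_fst, smul_eq_mul, ← hp, ← hp', Finset.mul_sum,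
      ← Finset.sum_add_distrib]
    exact Finset.sum_congr rfl fun i _ => by ring
  · simp only [Prod.snd_add, Prod.smul_snd, smul_eq_mul, ← hq, ← hq', Finset.mul_sum,
      ← Finset.sum_add_distrib]
    exact Finset.sum_congr rfl fun i _ => by ring

theorem zonotope_neg_mem (x y : ι → ℤ) {p : ℝ × ℝ} (hp : p ∈ zonotope x y) :
    -p ∈ zonotope x y := by
  obtain ⟨t, ht, h1, h2⟩ := hp
  exact ⟨fun i => -t i, fun i => by simpa using ht i, by simp [h1], by simp [h2]⟩

theorem signed_sum_mem_zonotope (x y ε : ι → ℤ) (hε : ∀ i, |ε i| = 1) :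
    (((∑ i, ε i * x i : ℤ) : ℝ), ((∑ i, ε i * y i : ℤ) : ℝ)) ∈ zonotope x y := by
  refine ⟨fun i => ε i, fun i => ?_, by push_cast; rfl, by push_cast; rfl⟩
  change |(ε i : ℝ)| ≤ 1
  exact_mod_cast (hε i).le

theorem two_dvd_signed_sum_sub (x ε : ι → ℤ) (hε : ∀ i, |ε i| = 1) :
    2 ∣ ∑ i, ε i * x i - ∑ i, x i := by
  rw [← Finset.sum_sub_distrib]
  refine Finset.dvd_sum fun i _ => ?_
  rcases (abs_eq (by norm_num)).1 (hε i) with h | h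
  · simp [h]
  · exact ⟨-x i, by rw [h]; ring⟩

theorem two_dvd_sum_abs_sub (x : ι → ℤ) : 2 ∣ ∑ i, |x i| - ∑ i, x i := by
  rw [← Finset.sum_sub_distrib]
  refine Finset.dvd_sum fun i _ => ?_
  rcases abs_choice (x i) with h | h
  · simp [h]
  · exact ⟨-x i, by rw [h]; ring⟩

theorem HasTripledPoint.of_linear {x y x' y' : ι → ℤ} (α β γ δ : ℤ)
    (hx : ∀ i, x i = α * x' i + β * y' i) (hy : ∀ i, y i = γ * x' i + δ * y' i)
    (h : HasTripledPoint x' y') : HasTripledPoint x y := by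
  obtain ⟨p, q, ⟨t, ht, h1, h2⟩, ⟨c, hc⟩, ⟨d, hd⟩⟩ := h
  simp only at h1 h2
  refine ⟨α * p + β * q, γ * p + δ * q, ⟨t, ht, ?_, ?_⟩, ⟨α * c + β * d, ?_⟩,
    ⟨γ * c + δ * d, ?_⟩⟩
  · have : ∑ i, t i * (x i : ℝ) = α * ∑ i, t i * (x' i : ℝ) + β * ∑ i, t i * (y' i : ℝ) := by
      rw [Finset.mul_sum, Finset.mul_sum, ← Finset.sum_add_distrib]
      exact Finset.sum_congr rfl fun i _ => by rw [hx]; push_cast; ring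
    rw [this, h1, h2]
    push_cast
    ring
  · have : ∑ i, t i * (y i : ℝ) = γ * ∑ i, t i * (x' i : ℝ) + δ * ∑ i, t i * (y' i : ℝ) := by
      rw [Finset.mul_sum, Finset.mul_sum, ← Finset.sum_add_distrib]
      exact Finset.sum_congr rfl fun i _ => by rw [hy]; push_cast; ring
    rw [this, h1, h2]
    push_cast
    ring
  · simp only [hx, Finset.sum_add_distrib, ← Finset.mul_sum]
    linear_combination α * hc + β * hd
  · simp only [hy, Finset.sum_add_distrib, ← Finset.mul_sum]
    linear_combination γ * hc + δ * hd

/-! ### Extreme points of symmetric convex sets -/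

/-- If the slice at abscissa `3` of a convex symmetric set lies between the ordinates `-3` and `3`,
and the set reaches far enough in both directions at odd integral points, then the two extreme
points are, up to a reflection, `(1, 5)` and `(5, -1)`. -/
theorem extreme_points_of_pos {S : Set (ℝ × ℝ)} (hS : Convex ℝ S) (hneg : ∀ p ∈ S, -p ∈ S)
    (hslice : ∀ β : ℝ, ((3 : ℝ), β) ∈ S → -3 < β ∧ β < 3) {a b X c : ℤ}
    (hab : ((a : ℝ), (b : ℝ)) ∈ S) (hXc : ((X : ℝ), (c : ℝ)) ∈ S)
    (hX : 5 ≤ X) (hXb : X ≤ b) (haX : |a| ≤ X) (ha : Odd a) (hc : Odd c) (hb : Odd b)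
    (hXo : Odd X) (ha0 : 0 < a) : X = 5 ∧ b = 5 ∧ a = 1 ∧ c = -1 := by
  have hbR : (X : ℝ) ≤ b := by exact_mod_cast hXb
  have hXR : (5 : ℝ) ≤ X := by exact_mod_cast hX
  -- The chord crosses abscissa 3 inside the slice; denominators are cleared.
  have seg : ∀ p q p' q' : ℝ, (p, q) ∈ S → (p', q') ∈ S → p ≤ 3 → 3 < p' →
      -3 * (p' - p) < q * (p' - 3) + q' * (3 - p) ∧
        q * (p' - 3) + q' * (3 - p) < 3 * (p' - p) := by
    intro p q p' q' h h' hp hp'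
    have hd : 0 < p' - p := by linarith
    have := hS h h' (a := (p' - 3) / (p' - p)) (b := (3 - p) / (p' - p))
      (div_nonneg (by linarith) hd.le) (div_nonneg (by linarith) hd.le)
      (by field_simp; ring)
    have e : ((p' - 3) / (p' - p)) • (p, q) + ((3 - p) / (p' - p)) • (p', q') =
        ((3 : ℝ), (q * (p' - 3) + q' * (3 - p)) / (p' - p)) := by
      ext
      · simp; field_simp; ring
      · simp; field_simp
    rw [e] at this
    obtain ⟨h1, h2⟩ := hslice _ this
    rw [lt_div_iff₀ hd] at h1
    rw [div_lt_iff₀ hd] at h2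
    exact ⟨h1, h2⟩
  have haX' : a ≤ X := (le_abs_self a).trans haX
  obtain ⟨k, rfl⟩ := ha
  by_cases hk : k = 0
  · subst hk
    have h1 := (seg _ _ _ _ hab hXc (by norm_num) (by linarith)).2
    have hab' : ((-1 : ℝ), (-b : ℝ)) ∈ S := by simpa using hneg _ hab
    have h2 := (seg _ _ _ _ hab' hXc (by norm_num) (by linarith)).1
    have h1' : b * (X - 3) + c * (3 - 1) < 3 * (X - 1) := by
      have : ((b * (X - 3) + c * (3 - 1) : ℤ) : ℝ) < ((3 * (X - 1) : ℤ) : ℝ) := by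
        push_cast at h1 ⊢
        linarith
      exact_mod_cast this
    have h2' : -3 * (X + 1) < -b * (X - 3) + c * (3 + 1) := by
      have : ((-3 * (X + 1) : ℤ) : ℝ) < ((-b * (X - 3) + c * (3 + 1) : ℤ) : ℝ) := by
        push_cast at h2 ⊢
        linarith
      exact_mod_cast this
    -- Eliminating `c` gives `3b(X - 3) < 9X - 3`, which fails for `b ≥ X ≥ 7`.
    have hX5 : X = 5 := by
      by_contra hne
      obtain ⟨j, rfl⟩ := hXo
      have : 3 ≤ j := by omega
      nlinarith
    subst hX5
    refine ⟨rfl, ?_, by norm_num, ?_⟩ <;> obtain ⟨j, rfl⟩ := hc <;> obtain ⟨l, rfl⟩ := hb <;> omega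
  -- Here `3 ≤ a ≤ b`, so the chord from the origin to `(a, b)` meets abscissa 3 at height `3b/a ≥
  -- 3`.
  · exfalso
    have hk3 : (3 : ℤ) ≤ 2 * k + 1 := by omega
    have haR : (3 : ℝ) ≤ ((2 * k + 1 : ℤ) : ℝ) := by exact_mod_cast hk3
    have haXR : ((2 * k + 1 : ℤ) : ℝ) ≤ X := by exact_mod_cast haX'
    have h0 : ((0 : ℝ), (0 : ℝ)) ∈ S := by
      have := hS hab (hneg _ hab) (a := 1 / 2) (b := 1 / 2) (by norm_num) (by norm_num)
        (by norm_num)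
      have e : ((1 / 2 : ℝ)) • ((((2 * k + 1 : ℤ) : ℝ)), (b : ℝ)) +
          (1 / 2 : ℝ) • -((((2 * k + 1 : ℤ) : ℝ)), (b : ℝ)) = (0, 0) := by
        rw [smul_neg, add_neg_cancel]
        rfl
      rwa [e] at this
    rcases haR.eq_or_lt with h | h
    · rw [← h] at hab
      have := (hslice _ hab).2
      linarith
    · have := (seg _ _ _ _ h0 hab (by norm_num) h).2
      linarith

theorem extreme_points {S : Set (ℝ × ℝ)} (hS : Convex ℝ S) (hneg : ∀ p ∈ S, -p ∈ S)
    (hslice : ∀ β : ℝ, ((3 : ℝ), β) ∈ S → -3 < β ∧ β < 3) {a b X c : ℤ}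
    (hab : ((a : ℝ), (b : ℝ)) ∈ S) (hXc : ((X : ℝ), (c : ℝ)) ∈ S)
    (hX : 5 ≤ X) (hXb : X ≤ b) (haX : |a| ≤ X) (ha : Odd a) (hc : Odd c) (hb : Odd b)
    (hXo : Odd X) : X = 5 ∧ b = 5 ∧ (a = 1 ∧ c = -1 ∨ a = -1 ∧ c = 1) := by
  rcases lt_trichotomy a 0 with h | rfl | h
  · have hS' : Convex ℝ {p : ℝ × ℝ | (p.1, -p.2) ∈ S} := by
      intro p hp q hq α β hα hβ hαβ
      have := hS hp hq hα hβ hαβ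
      have e : α • (p.1, -p.2) + β • (q.1, -q.2) =
          ((α • p + β • q).1, -(α • p + β • q).2) := by
        ext <;> simp
        ring
      rw [e] at this
      exact this
    have := extreme_points_of_pos (S := {p : ℝ × ℝ | (p.1, -p.2) ∈ S}) (a := -a) (c := -c)
      (b := b) (X := X) hS' (fun p hp => by simpa using hneg _ hp)
      (fun β hβ => by
        have := hslice _ hβ
        constructor <;> linarith)
      (by simpa using hneg _ hab) (by simpa using hXc) hX hXb (by simpa using haX) ha.neg
      hc.neg hb hXo (by omega)
    omega
  · simp at ha
  · have := extreme_points_of_pos hS hneg hslice hab hXc hX hXb haX ha hc hb hXo h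
    omega

/-! ### Right-hand edge and number of vectors -/

/-- The sign of `x`, or that of `y` when `x` vanishes. -/
def tieSign (x y : ℤ) : ℤ :=
  if 0 < x then 1 else if x < 0 then -1 else if 0 < y then 1 else -1

theorem abs_tieSign (x y : ℤ) : |tieSign x y| = 1 := by
  unfold tieSign
  split_ifs <;> simp

theorem tieSign_mul_self (x y : ℤ) : tieSign x y * x = |x| := by
  unfold tieSign
  split_ifs with h1 h2 h3
  · rw [abs_of_pos h1, one_mul]
  · rw [abs_of_neg h2]; ring
  all_goals
    have : x = 0 := by omega
    simp [this]

theorem tieSign_sub_mul_nonneg (x y : ℤ) : 0 ≤ (tieSign x y - tieSign x (-y)) * y := by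
  unfold tieSign
  split_ifs <;> omega

theorem two_le_abs_add_tieSign {x y : ℤ} (h : x ≠ 0 ∨ y ≠ 0) :
    2 ≤ 2 * |x| + (tieSign x y - tieSign x (-y)) * y := by
  by_cases hx : x = 0
  · subst hx
    have hy : y ≠ 0 := by simpa using h
    unfold tieSign
    rcases lt_or_gt_of_ne hy with h | h
    · simp [h, not_lt.2 h.le]; omega
    · simp [h, not_lt.2 h.le]; omega
  · have := Int.one_le_abs hx
    have := tieSign_sub_mul_nonneg x y
    omega

/-- The bracket is the length of the right-hand edge. A vector with `x i ≠ 0` adds at least 1 to the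
half-width; one with `x i = 0` adds `2|y i|` to that edge. -/
theorem card_le_sum_abs_add (x y : ι → ℤ) (h : ∀ i, x i ≠ 0 ∨ y i ≠ 0) :
    2 * (Fintype.card ι : ℤ) ≤ 2 * ∑ i, |x i| +
      (∑ i, tieSign (x i) (y i) * y i - ∑ i, tieSign (x i) (-y i) * y i) := by
  rw [Finset.mul_sum, ← Finset.sum_sub_distrib, ← Finset.sum_add_distrib]
  calc 2 * (Fintype.card ι : ℤ) = ∑ _i : ι, (2 : ℤ) := by simp [mul_comm]
    _ ≤ _ := Finset.sum_le_sum fun i _ => by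
      have := two_le_abs_add_tieSign (h i)
      linarith [sub_mul (tieSign (x i) (y i)) (tieSign (x i) (-y i)) (y i)]

/-- If the extreme value of the first coordinate is at most the number of vectors and is attained
at a single point, then all first coordinates are `±1`. -/
theorem abs_eq_one_of_sum_le_card (x y : ι → ℤ) (h : ∀ i, x i ≠ 0 ∨ y i ≠ 0)
    (hX : ∑ i, |x i| ≤ Fintype.card ι)
    (hy : ∑ i, tieSign (x i) (y i) * y i = ∑ i, tieSign (x i) (-y i) * y i) (i : ι) :
    |x i| = 1 := by
  have h0 : ∑ i, (tieSign (x i) (y i) - tieSign (x i) (-y i)) * y i = 0 := by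
    simp only [sub_mul, Finset.sum_sub_distrib, hy, sub_self]
  have h0' := (Finset.sum_eq_zero_iff_of_nonneg
    fun i _ => tieSign_sub_mul_nonneg (x i) (y i)).1 h0
  have h1 : ∀ j, 0 ≤ |x j| - 1 := fun j => by
    have := two_le_abs_add_tieSign (h j)
    rw [h0' j (Finset.mem_univ _)] at this
    omega
  have h2 : ∑ j, (|x j| - 1) = 0 := by
    refine le_antisymm ?_ (Finset.sum_nonneg fun j _ => h1 j)
    simpa using hX
  have := (Finset.sum_eq_zero_iff_of_nonneg fun j _ => h1 j).1 h2 i (Finset.mem_univ _)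
  omega

/-- The slice of the zonotope at abscissa `3` cannot lie strictly between `-3` and `3` when the
second coordinates have an odd sum and are at least as large as the first ones. -/
theorem slice_not_subset (x y : ι → ℤ) (hcard : 5 ≤ Fintype.card ι)
    (hne : ∀ i, x i ≠ 0 ∨ y i ≠ 0) (hxo : Odd (∑ i, x i)) (hyo : Odd (∑ i, y i))
    (hX : 3 ≤ ∑ i, |x i|) (hXY : ∑ i, |x i| ≤ ∑ i, |y i|)
    (hslice : ∀ β : ℝ, ((3 : ℝ), β) ∈ zonotope x y → -3 < β ∧ β < 3) : False := by
  have odd_of : ∀ z w : ℤ, 2 ∣ z - w → Odd w → Odd z := fun z w hd hw => by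
    rw [Int.odd_iff] at *
    omega
  have hXo : Odd (∑ i, |x i|) := odd_of _ _ (two_dvd_sum_abs_sub x) hxo
  have hYo : Odd (∑ i, |y i|) := odd_of _ _ (two_dvd_sum_abs_sub y) hyo
  have memX : ∀ f : ι → ℤ, (((∑ i, |x i| : ℤ) : ℝ),
      ((∑ i, tieSign (x i) (f i) * y i : ℤ) : ℝ)) ∈ zonotope x y := fun f => by
    have := signed_sum_mem_zonotope x y (fun i => tieSign (x i) (f i)) fun i => abs_tieSign _ _
    simpa only [tieSign_mul_self] using this
  have memY : ∀ f : ι → ℤ, (((∑ i, tieSign (y i) (f i) * x i : ℤ) : ℝ),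
      ((∑ i, |y i| : ℤ) : ℝ)) ∈ zonotope x y := fun f => by
    have := signed_sum_mem_zonotope x y (fun i => tieSign (y i) (f i)) fun i => abs_tieSign _ _
    simpa only [tieSign_mul_self] using this
  have oddX : ∀ f : ι → ℤ, Odd (∑ i, tieSign (x i) (f i) * y i) := fun f =>
    odd_of _ _ (two_dvd_signed_sum_sub y _ fun i => abs_tieSign _ _) hyo
  have oddY : ∀ f : ι → ℤ, Odd (∑ i, tieSign (y i) (f i) * x i) := fun f =>
    odd_of _ _ (two_dvd_signed_sum_sub x _ fun i => abs_tieSign _ _) hxo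
  have absY : ∀ f : ι → ℤ, |∑ i, tieSign (y i) (f i) * x i| ≤ ∑ i, |x i| := fun f =>
    (Finset.abs_sum_le_sum_abs _ _).trans
      (Finset.sum_le_sum fun i _ => by rw [abs_mul, abs_tieSign, one_mul])
  have hcnt := card_le_sum_abs_add x y hne
  by_cases hX3 : ∑ i, |x i| = 3
  -- The right-hand edge is in the slice and its ends have odd ordinates, so its length is at most
  -- 2, and `hcnt` would give `10 ≤ 6 + 2`.
  · have bound : ∀ f : ι → ℤ, -3 < ∑ i, tieSign (x i) (f i) * y i ∧
        ∑ i, tieSign (x i) (f i) * y i < 3 := fun f => by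
      have h := memX f
      rw [hX3] at h
      have := hslice _ (by exact_mod_cast h)
      exact_mod_cast this
    obtain ⟨h1, h2⟩ := bound y
    obtain ⟨h3, h4⟩ := bound fun i => -y i
    obtain ⟨j, hj⟩ := oddX y
    obtain ⟨l, hl⟩ := oddX fun i => -y i
    omega
  · have hX5 : 5 ≤ ∑ i, |x i| := by
      obtain ⟨j, hj⟩ := hXo
      omega
    have key : ∀ f g : ι → ℤ, ∑ i, |x i| = 5 ∧ ∑ i, |y i| = 5 ∧
        (∑ i, tieSign (y i) (f i) * x i = 1 ∧ ∑ i, tieSign (x i) (g i) * y i = -1 ∨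
          ∑ i, tieSign (y i) (f i) * x i = -1 ∧ ∑ i, tieSign (x i) (g i) * y i = 1) := fun f g =>
      extreme_points (zonotope_convex x y) (fun p hp => zonotope_neg_mem x y hp) hslice (memY f)
        (memX g) hX5 hXY (absY f) (oddY f) (oddX g) hYo hXo
    -- Changing one tie-break at a time shows that the rightmost and topmost points are unique.
    have k1 := key x y
    have k2 := key x fun i => -y i
    have k3 := key (fun i => -x i) y
    have hx1 := abs_eq_one_of_sum_le_card x y hne (by omega) (by omega)
    have hy1 := abs_eq_one_of_sum_le_card y x (fun i => (hne i).symm) (by omega) (by omega)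
    -- With all entries `±1`, both sums equal `∑ x i * y i`, but `k1` makes them opposite and
    -- nonzero.
    have e : ∑ i, tieSign (x i) (y i) * y i = ∑ i, tieSign (y i) (x i) * x i := by
      refine Finset.sum_congr rfl fun i _ => ?_
      rcases (abs_eq (by norm_num)).1 (hx1 i) with h | h <;>
        rcases (abs_eq (by norm_num)).1 (hy1 i) with h' | h' <;> simp [h, h', tieSign]
    omega

/-! ### Forms of minimal width -/

/-- A zonotope whose first coordinates have an odd sum and are minimal among all integral linear
forms of this kind has a tripled point. -/
theorem hasTripledPoint_of_minimal (x y : ι → ℤ) (hcard : 5 ≤ Fintype.card ι)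
    (hne : ∀ i, x i ≠ 0 ∨ y i ≠ 0) (hxo : Odd (∑ i, x i)) (hX : 3 ≤ ∑ i, |x i|)
    (hmin : ∀ k : ℤ, Odd (∑ i, (y i - k * x i)) → ∑ i, |x i| ≤ ∑ i, |y i - k * x i|) :
    HasTripledPoint x y := by
  by_contra hgood
  set X := ∑ i, |x i| with hXdef
  have hXpos : (0 : ℝ) < X := by exact_mod_cast (by omega : 0 < X)
  obtain ⟨β₀, hβ₀⟩ : ∃ β : ℝ, ((3 : ℝ), β) ∈ zonotope x y := by
    refine ⟨_, fun i => 3 / X * (tieSign (x i) (y i) : ℝ), fun i => ?_, ?_, rfl⟩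
    · have h : |((tieSign (x i) (y i) : ℤ) : ℝ)| = 1 := by exact_mod_cast abs_tieSign _ _
      rw [abs_mul, h, mul_one, abs_of_pos (by positivity), div_le_one hXpos]
      exact_mod_cast hX
    · have : ∑ i, (tieSign (x i) (y i) : ℝ) * x i = X := by
        rw [hXdef]
        push_cast
        refine Finset.sum_congr rfl fun i _ => ?_
        exact_mod_cast tieSign_mul_self (x i) (y i)
      simp only [mul_assoc, ← Finset.mul_sum, this]
      field_simp
  set W := ∑ i, y i with hW
  -- `3k` and `3(k + 2)` are consecutive forbidden ordinates around `β₀`.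
  set k := 2 * ⌊(β₀ - 3 * W) / 6⌋ + W with hk
  have hkR : (k : ℝ) = 2 * (⌊(β₀ - 3 * W) / 6⌋ : ℝ) + W := by rw [hk]; push_cast; ring
  have hlo : 3 * (k : ℝ) ≤ β₀ := by
    have := Int.floor_le ((β₀ - 3 * W) / 6)
    rw [hkR]; linarith
  have hhi : β₀ < 3 * (k : ℝ) + 6 := by
    have := Int.lt_floor_add_one ((β₀ - 3 * W) / 6)
    rw [hkR]; linarith
  have avoid : ∀ q : ℤ, 2 ∣ q - W → ((3 : ℝ), (3 * q : ℝ)) ∉ zonotope x y := fun q hq h =>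
    hgood ⟨1, q, by simpa using h, by
      obtain ⟨j, hj⟩ := hxo
      exact ⟨-j, by rw [hj]; ring⟩, hq⟩
  have hconv : ∀ β γ δ : ℝ, ((3 : ℝ), β) ∈ zonotope x y → ((3 : ℝ), δ) ∈ zonotope x y →
      β ≤ γ → γ ≤ δ → ((3 : ℝ), γ) ∈ zonotope x y := by
    intro β γ δ h1 h2 h3 h4
    have hsub := (zonotope_convex x y).segment_subset h1 h2
    apply hsub
    rcases h3.eq_or_lt with rfl | h3
    · exact left_mem_segment ℝ _ _
    have hd : 0 < δ - β := by linarith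
    refine ⟨(δ - γ) / (δ - β), (γ - β) / (δ - β), div_nonneg (by linarith) hd.le,
      div_nonneg (by linarith) hd.le, by field_simp; ring, ?_⟩
    ext
    · simp; field_simp; ring
    · simp; field_simp; ring
  have hk1 := avoid k (by omega)
  have hk2 := avoid (k + 2) (by omega)
  have e2 : (3 * ((k + 2 : ℤ) : ℝ)) = 3 * (k : ℝ) + 6 := by push_cast; ring
  rw [e2] at hk2
  have hslice : ∀ β : ℝ, ((3 : ℝ), β) ∈ zonotope x y → 3 * (k : ℝ) < β ∧ β < 3 * (k : ℝ) + 6 := by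
    intro β hβ
    constructor
    · by_contra hcon
      exact hk1 (hconv β _ β₀ hβ hβ₀ (not_lt.1 hcon) hlo)
    · by_contra hcon
      exact hk2 (hconv β₀ _ β hβ₀ hβ hhi.le (not_lt.1 hcon))
  -- Shearing by `k + 1` centers the slice at 0; since `k + 1` and `W` have opposite parities, the
  -- new sum is odd.
  have hsumy : ∑ i, (y i - (k + 1) * x i) = W - (k + 1) * ∑ i, x i := by
    rw [Finset.sum_sub_distrib, ← Finset.mul_sum]
  have hyo : Odd (∑ i, (y i - (k + 1) * x i)) := by
    rw [hsumy]
    obtain ⟨j, hj⟩ := hxo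
    rw [hj]
    exact ⟨-⌊(β₀ - 3 * W) / 6⌋ - 1 - (k + 1) * j, by rw [hk]; ring⟩
  refine slice_not_subset x (fun i => y i - (k + 1) * x i) hcard (fun i => ?_) hxo hyo hX
    (hmin _ hyo) fun β hβ => ?_
  · by_cases h : x i = 0
    · right
      simpa [h] using hne i
    · exact Or.inl h
  · obtain ⟨t, ht, h1, h2⟩ := hβ
    simp only at h1 h2
    have : ((3 : ℝ), β + 3 * (k + 1)) ∈ zonotope x y := by
      refine ⟨t, ht, h1, ?_⟩
      have : ∑ i, t i * (y i : ℝ) =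
          ∑ i, t i * ((y i - (k + 1) * x i : ℤ) : ℝ) + (k + 1) * ∑ i, t i * (x i : ℝ) := by
        rw [Finset.mul_sum, ← Finset.sum_add_distrib]
        exact Finset.sum_congr rfl fun i _ => by push_cast; ring
      rw [this, h1, h2]
      ring
    obtain ⟨h3, h4⟩ := hslice _ this
    constructor <;> linarith

theorem hasTripledPoint (x y : ι → ℤ) (hcard : 5 ≤ Fintype.card ι)
    (hne : ∀ i, x i ≠ 0 ∨ y i ≠ 0) (hodd : Odd (∑ i, x i) ∨ Odd (∑ i, y i))
    (hwidth : ∀ a b : ℤ, ∑ i, |a * x i + b * y i| ≠ 1) : HasTripledPoint x y := by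
  classical
  let P : ℕ → Prop := fun n => ∃ a b : ℤ, Odd (∑ i, (a * x i + b * y i)) ∧
    ∑ i, |a * x i + b * y i| = n
  have toP : ∀ a b : ℤ, Odd (∑ i, (a * x i + b * y i)) →
      P (∑ i, |a * x i + b * y i|).toNat := fun a b h =>
    ⟨a, b, h, (Int.toNat_of_nonneg (Finset.sum_nonneg fun i _ => abs_nonneg _)).symm⟩
  have hex : ∃ n, P n := by
    rcases hodd with h | h
    · exact ⟨_, toP 1 0 (by simpa using h)⟩
    · exact ⟨_, toP 0 1 (by simpa using h)⟩
  obtain ⟨a, b, hab, hN⟩ := Nat.find_spec hex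
  have hmin : ∀ c d : ℤ, Odd (∑ i, (c * x i + d * y i)) →
      ∑ i, |a * x i + b * y i| ≤ ∑ i, |c * x i + d * y i| := fun c d h => by
    have h1 := Nat.find_min' hex (toP c d h)
    have h2 : 0 ≤ ∑ i, |c * x i + d * y i| := Finset.sum_nonneg fun i _ => abs_nonneg _
    rw [hN]
    omega
  have hab0 : 0 < Int.gcd a b := by
    rw [Nat.pos_iff_ne_zero, Ne, Int.gcd_eq_zero_iff]
    rintro ⟨rfl, rfl⟩
    simp at hab
  obtain ⟨a', b', hcop, ha', hb'⟩ := Int.exists_gcd_one hab0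
  set g : ℤ := (Int.gcd a b : ℤ) with hg
  have hgpos : 1 ≤ g := by omega
  have hab' : ∀ i, a * x i + b * y i = g * (a' * x i + b' * y i) := fun i => by
    rw [ha', hb']; ring
  have hodd' : Odd (∑ i, (a' * x i + b' * y i)) := by
    simp only [hab', ← Finset.mul_sum] at hab
    exact (Int.odd_mul.1 hab).2
  have hle : ∑ i, |a' * x i + b' * y i| ≤ ∑ i, |a * x i + b * y i| := by
    refine Finset.sum_le_sum fun i _ => ?_
    rw [hab', abs_mul, abs_of_pos (by omega : 0 < g)]
    nlinarith [abs_nonneg (a' * x i + b' * y i)]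
  -- Bézout completes `(a', b')` to a unimodular matrix with second row `(-q, p)`.
  obtain ⟨p, q, hpq⟩ := Int.isCoprime_iff_gcd_eq_one.2 hcop
  have hx : ∀ i, x i = p * (a' * x i + b' * y i) + -b' * (-q * x i + p * y i) := fun i => by
    linear_combination -x i * hpq
  have hy : ∀ i, y i = q * (a' * x i + b' * y i) + a' * (-q * x i + p * y i) := fun i => by
    linear_combination -y i * hpq
  refine HasTripledPoint.of_linear p (-b') q a' hx hy
    (hasTripledPoint_of_minimal _ _ hcard (fun i => ?_) hodd' ?_ fun k hk => ?_)
  · by_contra! h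
    have h1 := hx i
    have h2 := hy i
    rw [h.1, h.2, mul_zero, mul_zero, add_zero] at h1 h2
    exact (hne i).elim (fun h => h h1) fun h => h h2
  · obtain ⟨j, hj⟩ := hodd'
    obtain ⟨l, hl⟩ := two_dvd_sum_abs_sub fun i => a' * x i + b' * y i
    have h1 := hwidth a' b'
    have h2 : 0 ≤ ∑ i, |a' * x i + b' * y i| := Finset.sum_nonneg fun i _ => abs_nonneg _
    omega
  · have e : ∀ i, -q * x i + p * y i - k * (a' * x i + b' * y i) =
        (-q - k * a') * x i + (p - k * b') * y i := fun i => by ring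
    simp only [e] at hk ⊢
    exact hle.trans (hmin _ _ hk)

end Zonotope

/-! ### Colorings of the Cayley graph -/

theorem LoopGraph.isBipartite_of_colorable {V : Type*} {X : LoopGraph V} {n : ℕ} (hn : n ≤ 2)
    (h : X.Colorable n) : X.IsBipartite := by
  obtain ⟨c, hc⟩ := h
  refine ⟨{v | (c v : ℕ) = 0}, {v | (c v : ℕ) = 0}ᶜ, Set.union_compl_self _, disjoint_compl_right,
    fun u v huv => ?_⟩
  have h1 := hc u v huv
  have h2 := (c u).isLt
  have h3 := (c v).isLt
  rw [Ne, Fin.ext_iff] at h1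
  simp only [Set.mem_ofPred_eq, Set.mem_compl_iff]
  omega

theorem LoopGraph.chromaticNumber_eq_three {V : Type*} {X : LoopGraph V} (h : X.Colorable 3)
    (hbip : ¬ X.IsBipartite) : X.chromaticNumber = 3 := by
  refine le_antisymm (iInf₂_le 3 h) (le_iInf₂ fun n hn => ?_)
  have : 3 ≤ n := by
    by_contra hlt
    exact hbip (LoopGraph.isBipartite_of_colorable (by omega) hn)
  exact_mod_cast this

theorem mem_columnSubgroup_of_eq {m : ℕ} (M : Matrix (Fin m) (Fin 2) ℤ) (a b : ℤ)
    (f : Fin m → ℤ) (hf : ∀ i, f i = a * M i 0 + b * M i 1) : f ∈ columnSubgroup M := by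
  have hcol : ∀ j : Fin 2, (fun i => M i j) ∈ columnSubgroup M := fun j =>
    AddSubgroup.subset_closure ⟨j, rfl⟩
  have e : f = a • (fun i => M i 0) + b • fun i => M i 1 := by
    ext i
    simp [hf]
  rw [e]
  exact add_mem (zsmul_mem (hcol 0) a) (zsmul_mem (hcol 1) b)

theorem mk_out_sub_mem {G : Type*} [AddCommGroup G] (H : AddSubgroup G) (g : G ⧸ H) (e : G) :
    (g + (e : G ⧸ H)).out - g.out - e ∈ H := by
  rw [← QuotientAddGroup.eq_zero_iff]
  simp only [QuotientAddGroup.mk_sub, QuotientAddGroup.out_eq']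
  abel

theorem sacg_adj {m r : ℕ} {M : Matrix (Fin m) (Fin r) ℤ}
    {g h : (Fin m → ℤ) ⧸ columnSubgroup M} (hgh : (sacg M).Adj g h) :
    ∃ i : Fin m, h.out - g.out - Pi.single i 1 ∈ columnSubgroup M ∨
      g.out - h.out - Pi.single i 1 ∈ columnSubgroup M := by
  obtain ⟨_, ⟨i, rfl | rfl⟩, rfl⟩ := hgh
  · exact ⟨i, Or.inl (mk_out_sub_mem _ _ _)⟩
  · refine ⟨i, Or.inr ?_⟩
    have := mk_out_sub_mem (columnSubgroup M)
      (g + -(QuotientAddGroup.mk (Pi.single i (1 : ℤ)))) (Pi.single i 1)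
    rwa [neg_add_cancel_right] at this

/-- An integer vector of norm 1 is some `± e_i`; if it is a relation, that generator is trivial. -/
theorem sum_abs_ne_one_of_not_hasLoop {m : ℕ} (M : Matrix (Fin m) (Fin 2) ℤ)
    (hloop : ¬ (sacg M).HasLoop) (a b : ℤ) : ∑ i, |a * M i 0 + b * M i 1| ≠ 1 := by
  intro hsum
  apply hloop
  obtain ⟨i, hi⟩ : ∃ i, a * M i 0 + b * M i 1 ≠ 0 := by
    by_contra! h
    simp [h] at hsum
  have hi1 := Int.one_le_abs hi
  rw [← Finset.add_sum_erase _ _ (Finset.mem_univ i)] at hsum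
  have hnn : ∀ j ∈ Finset.univ.erase i, 0 ≤ |a * M j 0 + b * M j 1| := fun j _ => abs_nonneg _
  have h0 : ∑ j ∈ Finset.univ.erase i, |a * M j 0 + b * M j 1| = 0 := by
    have := Finset.sum_nonneg hnn
    omega
  have hz := (Finset.sum_eq_zero_iff_of_nonneg hnn).1 h0
  set σ := a * M i 0 + b * M i 1 with hσ
  have hσ1 : |σ| = 1 := by omega
  have hσσ : σ * σ = 1 := by rw [← abs_mul_abs_self, hσ1, one_mul]
  have hmem : Pi.single i (1 : ℤ) ∈ columnSubgroup M := by
    refine mem_columnSubgroup_of_eq M (σ * a) (σ * b) _ fun j => ?_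
    have e : σ * a * M j 0 + σ * b * M j 1 = σ * (a * M j 0 + b * M j 1) := by ring
    rw [e]
    by_cases hj : j = i
    · subst hj
      rw [← hσ, hσσ, Pi.single_eq_same]
    · rw [abs_eq_zero.1 (hz j (by simp [hj])), Pi.single_eq_of_ne hj, mul_zero]
  refine ⟨0, _, ⟨i, Or.inl rfl⟩, ?_⟩
  rw [(QuotientAddGroup.eq_zero_iff _).2 hmem, add_zero]

/-- The parity of the coordinate sum descends to the quotient and flips along every edge. -/
theorem sacg_isBipartite_of_even {m : ℕ} (M : Matrix (Fin m) (Fin 2) ℤ)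
    (h : ∀ j, Even (∑ i, M i j)) : (sacg M).IsBipartite := by
  have hev : ∀ f ∈ columnSubgroup M, Even (∑ i, f i) := by
    intro f hf
    induction hf using AddSubgroup.closure_induction with
    | mem f hf =>
      obtain ⟨j, rfl⟩ := hf
      exact h j
    | zero => simp
    | add f g _ _ hf hg => simpa [Finset.sum_add_distrib] using hf.add hg
    | neg f _ hf => simpa using hf
  refine ⟨{g | Even (∑ i, g.out i)}, {g | Even (∑ i, g.out i)}ᶜ, Set.union_compl_self _,
    disjoint_compl_right, fun u v huv => ?_⟩
  obtain ⟨i, hi | hi⟩ := sacg_adj huv <;>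
  · have := hev _ hi
    simp only [Pi.sub_apply, Finset.sum_sub_distrib, Finset.sum_pi_single', Finset.mem_univ,
      if_true] at this
    simp only [Set.mem_ofPred_eq, Set.mem_compl_iff]
    rw [Int.even_iff] at *
    rw [Int.even_iff]
    omega

/-- Assigning to each generator an angle between `1 / 3` and `2 / 3` of a turn, compatibly with the
relations, yields a proper 3-coloring. -/
theorem sacg_colorable_three_of_angles {m r : ℕ} (M : Matrix (Fin m) (Fin r) ℤ) (s : Fin m → ℝ)
    (hs : ∀ i, 1 / 3 ≤ s i ∧ s i ≤ 2 / 3) (hrel : ∀ j, ∃ p : ℤ, ∑ i, (M i j : ℝ) * s i = p) :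
    (sacg M).Colorable 3 := by
  have hint : ∀ f ∈ columnSubgroup M, ∃ p : ℤ, ∑ i, (f i : ℝ) * s i = p := by
    intro f hf
    induction hf using AddSubgroup.closure_induction with
    | mem f hf =>
      obtain ⟨j, rfl⟩ := hf
      exact hrel j
    | zero => exact ⟨0, by simp⟩
    | add f g _ _ hf hg =>
      obtain ⟨p, hp⟩ := hf
      obtain ⟨q, hq⟩ := hg
      exact ⟨p + q, by simp [add_mul, Finset.sum_add_distrib, hp, hq]⟩
    | neg f _ hf =>
      obtain ⟨p, hp⟩ := hf
      exact ⟨-p, by simp [hp]⟩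
  let φ : (Fin m → ℤ) ⧸ columnSubgroup M → ℝ := fun g => ∑ i, (g.out i : ℝ) * s i
  -- `φ` depends on representatives only mod 1. Equal colors mean angles less than 1/3 apart, while
  -- an edge moves by 1/3 to 2/3.
  let c : (Fin m → ℤ) ⧸ columnSubgroup M → ℤ := fun g => ⌊3 * Int.fract (φ g)⌋
  have hc0 : ∀ g, 0 ≤ c g := fun g => Int.floor_nonneg.2 (by positivity)
  have hc3 : ∀ g, c g < 3 := fun g => Int.floor_lt.2 (by
    have := Int.fract_lt_one (φ g)
    push_cast
    linarith)
  have hstep : ∀ g h : (Fin m → ℤ) ⧸ columnSubgroup M, ∀ i,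
      h.out - g.out - Pi.single i 1 ∈ columnSubgroup M → c g ≠ c h := by
    intro g h i hmem heq
    obtain ⟨p, hp⟩ := hint _ hmem
    have hφ : φ h - φ g - s i = p := by
      rw [← hp]
      simp only [φ, Pi.sub_apply, Int.cast_sub, sub_mul, Finset.sum_sub_distrib]
      congr 1
      rw [Finset.sum_eq_single i] <;> simp +contextual
    have h1 := Int.floor_le (3 * Int.fract (φ g))
    have h2 := Int.lt_floor_add_one (3 * Int.fract (φ g))
    have h3 := Int.floor_le (3 * Int.fract (φ h))
    have h4 := Int.lt_floor_add_one (3 * Int.fract (φ h))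
    have heq' : ⌊3 * Int.fract (φ g)⌋ = ⌊3 * Int.fract (φ h)⌋ := heq
    rw [← heq'] at h3 h4
    have e1 := Int.self_sub_floor (φ g)
    have e2 := Int.self_sub_floor (φ h)
    obtain ⟨hs1, hs2⟩ := hs i
    have hN : ((p - ⌊φ h⌋ + ⌊φ g⌋ : ℤ) : ℝ) + s i = Int.fract (φ h) - Int.fract (φ g) := by
      push_cast
      linarith
    have hlt : ((p - ⌊φ h⌋ + ⌊φ g⌋ : ℤ) : ℝ) < ((0 : ℤ) : ℝ) := by
      push_cast at hN ⊢
      linarith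
    have hgt : ((-1 : ℤ) : ℝ) < ((p - ⌊φ h⌋ + ⌊φ g⌋ : ℤ) : ℝ) := by
      push_cast at hN ⊢
      linarith
    have hlt' := Int.cast_lt.1 hlt
    have hgt' := Int.cast_lt.1 hgt
    omega
  refine ⟨fun g => ⟨(c g).toNat, by have := hc3 g; omega⟩, fun g h hgh heq => ?_⟩
  have heq' : c g = c h := by
    have h1 := hc0 g
    have h2 := hc0 h
    simp only [Fin.mk.injEq] at heq
    omega
  obtain ⟨i, hi | hi⟩ := sacg_adj hgh
  · exact hstep g h i hi heq'
  · exact hstep h g i hi heq'.symm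

theorem sacg_colorable_three_of_hasTripledPoint {m : ℕ} (M : Matrix (Fin m) (Fin 2) ℤ)
    (h : HasTripledPoint (fun i => M i 0) fun i => M i 1) : (sacg M).Colorable 3 := by
  obtain ⟨p, q, ⟨t, ht, h1, h2⟩, ⟨k, hk⟩, ⟨l, hl⟩⟩ := h
  simp only at h1 h2
  have hsum : ∀ f : Fin m → ℤ, ∀ n w : ℤ, ∑ i, t i * (f i : ℝ) = 3 * n → n - ∑ i, f i = 2 * w →
      ∑ i, (f i : ℝ) * (1 / 2 + t i / 6) = ((n - w : ℤ) : ℝ) := by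
    intro f n w hn hw
    have e : ∑ i, (f i : ℝ) * (1 / 2 + t i / 6) =
        1 / 2 * ((∑ i, f i : ℤ) : ℝ) + 1 / 6 * ∑ i, t i * (f i : ℝ) := by
      push_cast
      rw [Finset.mul_sum, Finset.mul_sum, ← Finset.sum_add_distrib]
      exact Finset.sum_congr rfl fun i _ => by ring
    have hw' : ∑ i, f i = n - 2 * w := by omega
    rw [e, hn, hw']
    push_cast
    ring
  refine sacg_colorable_three_of_angles M (fun i => 1 / 2 + t i / 6) (fun i => ?_) fun j => ?_
  · have := abs_le.1 (ht i)
    constructor <;> linarith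
  · fin_cases j
    · exact ⟨_, hsum _ p k h1 hk⟩
    · exact ⟨_, hsum _ q l h2 hl⟩

theorem theorem1p1 (m : ℕ) (hm : 5 ≤ m) (M : Matrix (Fin m) (Fin 2) ℤ)
    (hrow : ∀ i : Fin m, M i ≠ 0)
    (hbip : ¬ (sacg M).IsBipartite) (hloop : ¬ (sacg M).HasLoop) :
    (sacg M).chromaticNumber = 3 := by
  refine LoopGraph.chromaticNumber_eq_three (sacg_colorable_three_of_hasTripledPoint M
    (hasTripledPoint _ _ (by simpa using hm) (fun i => ?_) ?_
      (sum_abs_ne_one_of_not_hasLoop M hloop))) hbip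
  · by_contra! h
    refine hrow i (funext fun j => ?_)
    fin_cases j
    · exact h.1
    · exact h.2
  · by_contra! h
    refine hbip (sacg_isBipartite_of_even M fun j => ?_)
    fin_cases j
    · exact Int.not_odd_iff_even.1 h.1
    · exact Int.not_odd_iff_even.1 h.2
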